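/- **Truth values algebras.** A *truth values algebra* is a set $\mathcal B$ with a subset $\mathcal B^+$ (the positive truth values), sets $\mathcal A,\mathcal E\subseteq\wp(\mathcal B)$, elements $\tilde\top,\tilde\bot\in\mathcal B$, binary operations $\tilde\Rightarrow,\tilde\wedge,\tilde\vee$ on $\mathcal B$ and functions $\tilde\forall:\mathcal A\to\mathcal B$, $\tilde\exists:\mathcal E\to\mathcal B$ such that, for all $a,b,c\in\mathcal B$, $A\in\mathcal A$, $E\in\mathcal E$ (with $\tilde\Rightarrow$ associating to the right): if $a\,\tilde\Rightarrow\,b\in\mathcal B^+$ and $a\in\mathcal B^+$ then $b\in\mathcal B^+$; the elements $a\tilde\Rightarrow b\tilde\Rightarrow a$, $\;(a\tilde\Rightarrow b\tilde\Rightarrow c)\tilde\Rightarrow(a\tilde\Rightarrow b)\tilde\Rightarrow a\tilde\Rightarrow c$, $\;\tilde\top$, $\;\tilde\bot\tilde\Rightarrow a$, $\;a\tilde\Rightarrow b\tilde\Rightarrow(a\tilde\wedge b)$, $\;(a\tilde\wedge b)\tilde\Rightarrow a$, $\;(a\tilde\wedge b)\tilde\Rightarrow b$, $\;a\tilde\Rightarrow(a\tilde\vee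 b)$, $\;b\tilde\Rightarrow(a\tilde\vee b)$, $\;(a\tilde\vee b)\tilde\Rightarrow(a\tilde\Rightarrow c)\tilde\Rightarrow(b\tilde\Rightarrow c)\tilde\Rightarrow c$ are in $\mathcal B^+$; the sets $a\tilde\Rightarrow A=\{a\tilde\Rightarrow e\mid e\in A\}$ and $E\tilde\Rightarrow a=\{e\tilde\Rightarrow a\mid e\in E\}$ are in $\mathcal A$; if $A\subseteq\mathcal B^+$ then $\tilde\forall A\in\mathcal B^+$; $\tilde\forall(a\tilde\Rightarrow A)\tilde\Rightarrow a\tilde\Rightarrow\tilde\forall A\in\mathcal B^+$; if $a\in A$ then $\tilde\forall A\,\tilde\Rightarrow\,a\in\mathcal B^+$; if $a\in E$ then $a\,\tilde\Rightarrow\,\tilde\exists E\in\mathcal B^+$; and $\tilde\exists E\tilde\Rightarrow\tilde\forall(E\tilde\Rightarrow a)\tilde\Rightarrow a\in\mathcal B^+$. It is *full* if $\mathcal A=\mathcal E=\wp(\mathcal B)$. It is *ordered* if it is equipped with an order relation $\sqsubseteq$ on $\mathcal B$ such that $\mathcal B^+$ is upward closed, $\tilde\top$ is a maximal element, $\tilde\wedge$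 and $\tilde\vee$ are monotone, $\tilde\Rightarrow$ is left anti-monotone and right monotone, and $\tilde\forall,\tilde\exists$ are monotone in the following sense: $\tilde\forall A\sqsubseteq\tilde\forall A'$ whenever every $y\in A'$ has some $x\in A$ with $x\sqsubseteq y$, and $\tilde\exists E\sqsubseteq\tilde\exists E'$ whenever every $x\in E$ has some $y\in E'$ with $x\sqsubseteq y$. It is *complete* if every subset of $\mathcal B$ has a greatest lower bound for $\sqsubseteq$. **Theories and models.** Consider a language of many-sorted first-order predicate logic (with infinitely many variables of each sort, and connectives and quantifiers $\top,\bot,\Rightarrow,\wedge,\vee,\forall,\exists$). A *theory* $\mathcal T,\equiv$ *in deduction modulo* consists of a set $\mathcal T$ of formulae (the axioms) and the congruence $\equiv$ on terms and on formulae generated by a confluent rewrite system that rewrites terms to terms of the same sort and atomic formulae to formulae. For a full truth values algebra $\mathcal B$, a *$\mathcal B$-valued structure* consists of a non-empty domain $\mathcal M_s$ for each sort $s$, a function between the domains for each function symbol, and a $\mathcal B$-valued function on the domains for each predicate symbol, according to the ranks of the symbols. The denotation $[\![\cdot]\!]_\varphi$ of terms and formulae under an assignment $\varphi$ is defined by recursion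 in the usual way, $\top,\bot,\Rightarrow,\wedge,\vee$ being interpreted by the corresponding operations of $\mathcal B$, and $[\![\forall x\,A]\!]_\varphi=\tilde\forall\{[\![A]\!]_{\varphi+\langle x,e\rangle}\mid e\in\mathcal M_s\}$, $[\![\exists x\,A]\!]_\varphi=\tilde\exists\{[\![A]\!]_{\varphi+\langle x,e\rangle}\mid e\in\mathcal M_s\}$ for $x$ of sort $s$. The structure is a *model* of $\mathcal T,\equiv$ if $[\![A]\!]_\varphi\in\mathcal B^+$ for every $A\in\mathcal T$ and every $\varphi$, and $[\![A]\!]_\varphi=[\![B]\!]_\varphi$ for every $\varphi$ and all terms or formulae $A\equiv B$. The theory is *super-consistent* if it has a $\mathcal B$-valued model for every full, ordered and complete truth values algebra $\mathcal B$. **Proofs.** Proof-terms are given by $$\pi::=\alpha\mid\lambda\alpha\,\pi\mid(\pi\,\pi')\mid\langle\pi,\pi'\rangle\mid fst(\pi)\mid snd(\pi)\mid i(\pi)\mid j(\pi)\mid(\delta\ \pi_1\ \alpha\pi_2\ \beta\pi_3)\mid I\mid(\delta_\bot\ \pi)\mid\lambda x\,\pi\mid(\pi\,t)\mid\langle t,\pi\rangle\mid(\delta_\exists\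 \pi\ x\alpha\pi')$$ where $\alpha,\beta$ are proof variables, $x$ is a term variable and $t$ is a term. Reduction $\rhd$ is the closure under all proof-term constructors of $(\lambda\alpha\,\pi_1\ \pi_2)\rhd(\pi_2/\alpha)\pi_1$, $\;fst\langle\pi_1,\pi_2\rangle\rhd\pi_1$, $\;snd\langle\pi_1,\pi_2\rangle\rhd\pi_2$, $\;(\delta\ i(\pi_1)\ \alpha\pi_2\ \beta\pi_3)\rhd(\pi_1/\alpha)\pi_2$, $\;(\delta\ j(\pi_1)\ \alpha\pi_2\ \beta\pi_3)\rhd(\pi_1/\beta)\pi_3$, $\;(\lambda x\,\pi\ t)\rhd(t/x)\pi$, $\;(\delta_\exists\ \langle t,\pi_1\rangle\ x\alpha\pi_2)\rhd(t/x,\pi_1/\alpha)\pi_2$, where in the last two rules $t$ and $x$ have the same sort. A proof-term $\pi$ is a *proof in* $\mathcal T,\equiv$ if, for some finite context $\Gamma$ of hypotheses (axioms of $\mathcal T$ or other assumptions) and some formula $A$, $\pi$ is a proof of $\Gamma\vdash_\equiv A$, that is, $\Gamma\vdash_\equiv\pi:A$ is derivable by the rules of intuitionistic natural deduction modulo $\equiv$,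 each proof-term constructor corresponding to one rule (axiom, introduction or elimination), with the formulae in the rules matched up to $\equiv$. **Theorem (Normalization).** If the theory $\mathcal T,\equiv$ is super-consistent, then all proofs in $\mathcal T,\equiv$ strongly normalize: no proof in $\mathcal T,\equiv$ starts an infinite $\rhd$-reduction sequence. -/

import Mathlib

universe u v

namespace DeductionModulo

/-! ## Truth values algebras -/

/-- A truth values algebra on the set `B`: `pos` is the set of positive truth values, `AA` and `EE`
are the families of subsets of `B` on which the operations `fa` and `ex` are defined, and `pos` is
closed by the intuitionistic deduction rules. -/
structure TruthValuesAlgebra (B : Type u) where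
  pos : Set B
  AA : Set (Set B)
  EE : Set (Set B)
  top : B
  bot : B
  imp : B → B → B
  and : B → B → B
  or : B → B → B
  fa : (A : Set B) → A ∈ AA → B
  ex : (E : Set B) → E ∈ EE → B
  modus_ponens : ∀ a b, imp a b ∈ pos → a ∈ pos → b ∈ pos
  imp_k : ∀ a b, imp a (imp b a) ∈ pos
  imp_s : ∀ a b c, imp (imp a (imp b c)) (imp (imp a b) (imp a c)) ∈ pos
  top_mem : top ∈ pos
  bot_elim : ∀ a, imp bot a ∈ pos
  and_intro : ∀ a b, imp a (imp b (and a b)) ∈ pos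
  and_left : ∀ a b, imp (and a b) a ∈ pos
  and_right : ∀ a b, imp (and a b) b ∈ pos
  or_left : ∀ a b, imp a (or a b) ∈ pos
  or_right : ∀ a b, imp b (or a b) ∈ pos
  or_elim : ∀ a b c, imp (or a b) (imp (imp a c) (imp (imp b c) c)) ∈ pos
  imp_set_mem : ∀ a, ∀ A ∈ AA, (fun e => imp a e) '' A ∈ AA
  set_imp_mem : ∀ a, ∀ E ∈ EE, (fun e => imp e a) '' E ∈ AA
  fa_intro : ∀ A (hA : A ∈ AA), (∀ a ∈ A, a ∈ pos) → fa A hA ∈ pos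
  fa_imp : ∀ a A (hA : A ∈ AA),
    imp (fa ((fun e => imp a e) '' A) (imp_set_mem a A hA)) (imp a (fa A hA)) ∈ pos
  fa_elim : ∀ A (hA : A ∈ AA), ∀ a ∈ A, imp (fa A hA) a ∈ pos
  ex_intro : ∀ E (hE : E ∈ EE), ∀ a ∈ E, imp a (ex E hE) ∈ pos
  ex_elim : ∀ a E (hE : E ∈ EE),
    imp (ex E hE) (imp (fa ((fun e => imp e a) '' E) (set_imp_mem a E hE)) a) ∈ pos

namespace TruthValuesAlgebra

variable {B : Type u}

/-- A truth values algebra is full if `fa` and `ex` are defined on all subsets. -/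
structure IsFull (𝔹 : TruthValuesAlgebra B) : Prop where
  AA_eq : 𝔹.AA = Set.univ
  EE_eq : 𝔹.EE = Set.univ

/-- The truth values algebra `𝔹` together with the order `≤` of `B` is an ordered truth values
algebra. The order is extended to sets of truth values so that `fa`, which is a kind of greatest
lower bound, is monotone when every element of the larger set is above some element of the smaller
set, and `ex`, a kind of least upper bound, is monotone when every element of the smaller set is
below some element of the larger set. -/
structure IsOrdered [PartialOrder B] (𝔹 : TruthValuesAlgebra B) : Prop where
  pos_upward : ∀ a b, a ≤ b → a ∈ 𝔹.pos → b ∈ 𝔹.pos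
  top_maximal : IsMax 𝔹.top
  and_mono : ∀ a a' b b', a ≤ a' → b ≤ b' → 𝔹.and a b ≤ 𝔹.and a' b'
  or_mono : ∀ a a' b b', a ≤ a' → b ≤ b' → 𝔹.or a b ≤ 𝔹.or a' b'
  imp_mono : ∀ a a' b b', a' ≤ a → b ≤ b' → 𝔹.imp a b ≤ 𝔹.imp a' b'
  fa_mono : ∀ A A' (hA : A ∈ 𝔹.AA) (hA' : A' ∈ 𝔹.AA),
    (∀ y ∈ A', ∃ x ∈ A, x ≤ y) → 𝔹.fa A hA ≤ 𝔹.fa A' hA'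
  ex_mono : ∀ E E' (hE : E ∈ 𝔹.EE) (hE' : E' ∈ 𝔹.EE),
    (∀ x ∈ E, ∃ y ∈ E', x ≤ y) → 𝔹.ex E hE ≤ 𝔹.ex E' hE'

end TruthValuesAlgebra

/-- An order is complete if every subset has a greatest lower bound. -/
def IsCompleteOrder (B : Type u) [PartialOrder B] : Prop :=
  ∀ X : Set B, ∃ g, IsGLB X g

/-! ## Many-sorted predicate logic -/

/-- A language of many-sorted predicate logic. A function symbol `f` has rank
`⟨fnDom f 0, …, fnDom f (fnArity f - 1), fnCod f⟩`, and similarly for predicate symbols. -/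
structure Language where
  Srt : Type u
  Fn : Type u
  fnArity : Fn → ℕ
  fnDom : (f : Fn) → Fin (fnArity f) → Srt
  fnCod : Fn → Srt
  Pr : Type u
  prArity : Pr → ℕ
  prDom : (P : Pr) → Fin (prArity P) → Srt

/-- Terms of each sort. There are infinitely many variables `var s 0`, `var s 1`, … of each sort
`s`. Bound variables are represented by de Bruijn indices, counted separately for each sort:
a binder for a variable of sort `s` binds the variable `var s 0`, turns `var s (n + 1)` into the
variable known as `var s n` outside the binder, and does not affect the variables of the other
sorts. -/
inductive Term (L : Language.{u}) : L.Srt → Type u where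
  | var (s : L.Srt) (n : ℕ) : Term L s
  | app (f : L.Fn) (ts : (i : Fin (L.fnArity f)) → Term L (L.fnDom f i)) : Term L (L.fnCod f)

/-- Formulae, identified up to renaming of bound variables. In `all s A` and `ex s A`, a variable of
sort `s` is bound in `A`. -/
inductive Formula (L : Language.{u}) : Type u where
  | atom (P : L.Pr) (ts : (i : Fin (L.prArity P)) → Term L (L.prDom P i)) : Formula L
  | top : Formula L
  | bot : Formula L
  | imp (A B : Formula L) : Formula L
  | and (A B : Formula L) : Formula L
  | or (A B : Formula L) : Formula L
  | all (s : L.Srt) (A : Formula L) : Formula L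
  | ex (s : L.Srt) (A : Formula L) : Formula L

section Substitution

variable {L : Language.{u}}

open Classical in
/-- The sequence of values for the variables of all sorts that gives `a` to `var s 0`, gives
to `var s (n + 1)` what `φ` gives to `var s n`, and agrees with `φ` on the other sorts. Used for the
extension of an assignment, and for the extension of a substitution. -/
noncomputable def cons {F : L.Srt → Type v} {s : L.Srt} (a : F s) (φ : (s : L.Srt) → ℕ → F s) :
    (s : L.Srt) → ℕ → F s :=
  Function.update φ s (fun n => Nat.casesOn n a (φ s))

/-- Simultaneous substitution in a term. -/
def Term.subst (σ : (s : L.Srt) → ℕ → Term L s) : {s : L.Srt} → Term L s → Term L s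
  | _, .var s n => σ s n
  | _, .app f ts => .app f (fun i => (ts i).subst σ)

open Classical in
/-- The substitution that moves an expression under a binder for a variable of sort `s`. -/
noncomputable def shift (s : L.Srt) : (r : L.Srt) → ℕ → Term L r :=
  fun r n => .var r (if r = s then n + 1 else n)

/-- The substitution `σ`, moved under a binder for a variable of sort `s`. -/
noncomputable def lift (s : L.Srt) (σ : (r : L.Srt) → ℕ → Term L r) : (r : L.Srt) → ℕ → Term L r :=
  cons (F := Term L) (Term.var s 0) (fun r n => (σ r n).subst (shift s))

/-- The substitution `t / x`, where `x` is the variable bound by a binder that is removed. -/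
noncomputable def single {s : L.Srt} (t : Term L s) : (r : L.Srt) → ℕ → Term L r :=
  cons (F := Term L) t Term.var

/-- Simultaneous (capture-avoiding) substitution in a formula. -/
noncomputable def Formula.subst : ((s : L.Srt) → ℕ → Term L s) → Formula L → Formula L
  | σ, .atom P ts => .atom P (fun i => (ts i).subst σ)
  | _, .top => .top
  | _, .bot => .bot
  | σ, .imp A B => .imp (A.subst σ) (B.subst σ)
  | σ, .and A B => .and (A.subst σ) (B.subst σ)
  | σ, .or A B => .or (A.subst σ) (B.subst σ)
  | σ, .all s A => .all s (A.subst (lift s σ))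
  | σ, .ex s A => .ex s (A.subst (lift s σ))

end Substitution

/-! ## Structures valued in a truth values algebra -/

/-- A `B`-valued structure for the language `L`, with a non-empty domain for each sort. -/
structure ValuedStructure (L : Language.{u}) (B : Type u) where
  Dom : L.Srt → Type v
  dom_nonempty : ∀ s, Nonempty (Dom s)
  fn : (f : L.Fn) → ((i : Fin (L.fnArity f)) → Dom (L.fnDom f i)) → Dom (L.fnCod f)
  pr : (P : L.Pr) → ((i : Fin (L.prArity P)) → Dom (L.prDom P i)) → B

namespace ValuedStructure

variable {L : Language.{u}} {B : Type u}

/-- An assignment of elements of the domains to the variables. -/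
abbrev Assignment (M : ValuedStructure.{u, v} L B) : Type (max u v) :=
  (s : L.Srt) → ℕ → M.Dom s

/-- The denotation of a term. -/
def termDenote (M : ValuedStructure.{u, v} L B) (φ : M.Assignment) :
    {s : L.Srt} → Term L s → M.Dom s
  | _, .var s n => φ s n
  | _, .app f ts => M.fn f (fun i => M.termDenote φ (ts i))

/-- The denotation of a formula, for a full truth values algebra (where it is always defined). -/
noncomputable def denote (M : ValuedStructure.{u, v} L B) (𝔹 : TruthValuesAlgebra B)
    (h : 𝔹.IsFull) : M.Assignment → Formula L → B
  | φ, .atom P ts => M.pr P (fun i => M.termDenote φ (ts i))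
  | _, .top => 𝔹.top
  | _, .bot => 𝔹.bot
  | φ, .imp A C => 𝔹.imp (M.denote 𝔹 h φ A) (M.denote 𝔹 h φ C)
  | φ, .and A C => 𝔹.and (M.denote 𝔹 h φ A) (M.denote 𝔹 h φ C)
  | φ, .or A C => 𝔹.or (M.denote 𝔹 h φ A) (M.denote 𝔹 h φ C)
  | φ, .all s A =>
      𝔹.fa (Set.range (fun e : M.Dom s => M.denote 𝔹 h (cons (F := M.Dom) e φ) A))
        (by rw [h.AA_eq]; exact Set.mem_univ _)
  | φ, .ex s A =>
      𝔹.ex (Set.range (fun e : M.Dom s => M.denote 𝔹 h (cons (F := M.Dom) e φ) A))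
        (by rw [h.EE_eq]; exact Set.mem_univ _)

/-- The formula `A` is valid in `M`. -/
def Valid (M : ValuedStructure.{u, v} L B) (𝔹 : TruthValuesAlgebra B) (h : 𝔹.IsFull)
    (A : Formula L) : Prop :=
  ∀ φ : M.Assignment, M.denote 𝔹 h φ A ∈ 𝔹.pos

end ValuedStructure

/-! ## Theories in deduction modulo -/

/-- A rewrite system: rules that rewrite terms to terms of the same sort, and rules that rewrite
atomic formulae to formulae. -/
structure RewriteSystem (L : Language.{u}) where
  termRule : (s : L.Srt) → Term L s → Term L s → Prop
  atomRule : (P : L.Pr) → ((i : Fin (L.prArity P)) → Term L (L.prDom P i)) → Formula L → Prop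

namespace RewriteSystem

variable {L : Language.{u}}

/-- One-step rewriting of terms: an instance of a rule is applied at some place. -/
inductive TermStep (R : RewriteSystem L) : (s : L.Srt) → Term L s → Term L s → Prop where
  | rule {s : L.Srt} {l r : Term L s} (σ : (s : L.Srt) → ℕ → Term L s) :
      R.termRule s l r → TermStep R s (l.subst σ) (r.subst σ)
  | app (f : L.Fn) (ts : (i : Fin (L.fnArity f)) → Term L (L.fnDom f i))
      (i : Fin (L.fnArity f)) (t : Term L (L.fnDom f i)) :
      TermStep R (L.fnDom f i) (ts i) t →
      TermStep R (L.fnCod f) (.app f ts) (.app f (Function.update ts i t))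

/-- One-step rewriting of formulae: an instance of a rule is applied at some place. -/
inductive FormulaStep (R : RewriteSystem L) : Formula L → Formula L → Prop where
  | rule {P : L.Pr} {ls : (i : Fin (L.prArity P)) → Term L (L.prDom P i)} {r : Formula L}
      (σ : (s : L.Srt) → ℕ → Term L s) :
      R.atomRule P ls r → FormulaStep R ((Formula.atom P ls).subst σ) (r.subst σ)
  | atom (P : L.Pr) (ts : (i : Fin (L.prArity P)) → Term L (L.prDom P i))
      (i : Fin (L.prArity P)) (t : Term L (L.prDom P i)) :
      R.TermStep (L.prDom P i) (ts i) t →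
      FormulaStep R (.atom P ts) (.atom P (Function.update ts i t))
  | imp_left {A A' : Formula L} (B : Formula L) :
      FormulaStep R A A' → FormulaStep R (.imp A B) (.imp A' B)
  | imp_right (A : Formula L) {B B' : Formula L} :
      FormulaStep R B B' → FormulaStep R (.imp A B) (.imp A B')
  | and_left {A A' : Formula L} (B : Formula L) :
      FormulaStep R A A' → FormulaStep R (.and A B) (.and A' B)
  | and_right (A : Formula L) {B B' : Formula L} :
      FormulaStep R B B' → FormulaStep R (.and A B) (.and A B')
  | or_left {A A' : Formula L} (B : Formula L) :
      FormulaStep R A A' → FormulaStep R (.or A B) (.or A' B)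
  | or_right (A : Formula L) {B B' : Formula L} :
      FormulaStep R B B' → FormulaStep R (.or A B) (.or A B')
  | all (s : L.Srt) {A A' : Formula L} :
      FormulaStep R A A' → FormulaStep R (.all s A) (.all s A')
  | ex (s : L.Srt) {A A' : Formula L} :
      FormulaStep R A A' → FormulaStep R (.ex s A) (.ex s A')

end RewriteSystem

/-- Confluence of a one-step rewrite relation. -/
def Confluent {α : Type u} (r : α → α → Prop) : Prop :=
  ∀ a b c, Relation.ReflTransGen r a b → Relation.ReflTransGen r a c →
    ∃ d, Relation.ReflTransGen r b d ∧ Relation.ReflTransGen r c d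

/-- A theory in deduction modulo: a set of axioms, and a confluent rewrite system. -/
structure Theory (L : Language.{u}) where
  axioms : Set (Formula L)
  rules : RewriteSystem L
  term_confluent : ∀ s, Confluent (rules.TermStep s)
  formula_confluent : Confluent rules.FormulaStep

namespace Theory

variable {L : Language.{u}}

/-- The congruence of a theory, on terms. -/
def TermEquiv (T : Theory L) {s : L.Srt} (t t' : Term L s) : Prop :=
  Relation.EqvGen (T.rules.TermStep s) t t'

/-- The congruence of a theory, on formulae. -/
def FormulaEquiv (T : Theory L) (A A' : Formula L) : Prop :=
  Relation.EqvGen T.rules.FormulaStep A A'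

/-- The structure `M`, valued in the full truth values algebra `𝔹`, is a model of the theory `T`. -/
structure IsModel (T : Theory L) {B : Type u} (𝔹 : TruthValuesAlgebra B) (h : 𝔹.IsFull)
    (M : ValuedStructure.{u, v} L B) : Prop where
  valid : ∀ A ∈ T.axioms, M.Valid 𝔹 h A
  term_eq : ∀ (s : L.Srt) (t t' : Term L s), T.TermEquiv t t' →
    ∀ φ : M.Assignment, M.termDenote φ t = M.termDenote φ t'
  formula_eq : ∀ A A' : Formula L, T.FormulaEquiv A A' →
    ∀ φ : M.Assignment, M.denote 𝔹 h φ A = M.denote 𝔹 h φ A'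

/-- A theory is super-consistent if it has a `𝔹`-valued model for all full, ordered and complete
truth values algebras `𝔹`. -/
def SuperConsistent (T : Theory L) : Prop :=
  ∀ (B : Type u) [PartialOrder B] (𝔹 : TruthValuesAlgebra B) (h : 𝔹.IsFull),
    𝔹.IsOrdered → IsCompleteOrder B → ∃ M : ValuedStructure.{u, v} L B, T.IsModel 𝔹 h M

end Theory

/-! ## Proof-terms and proof reduction -/

/-- Proof-terms. Proof variables are de Bruijn indices, and term variables are bound as in formulae.
In standard notation, the constructors are `α`, `λα π`, `(π π')`, `⟨π, π'⟩`, `fst(π)`, `snd(π)`,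
`i(π)`, `j(π)`, `(δ π απ₁ βπ₂)`, `I`, `(δ_⊥ π)`, `λx π`, `(π t)`, `⟨t, π⟩` and `(δ_∃ π xαπ')`. -/
inductive ProofTerm (L : Language.{u}) : Type u where
  | var (n : ℕ) : ProofTerm L
  | lam (p : ProofTerm L) : ProofTerm L
  | app (p q : ProofTerm L) : ProofTerm L
  | pair (p q : ProofTerm L) : ProofTerm L
  | fst (p : ProofTerm L) : ProofTerm L
  | snd (p : ProofTerm L) : ProofTerm L
  | inl (p : ProofTerm L) : ProofTerm L
  | inr (p : ProofTerm L) : ProofTerm L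
  | orElim (p q r : ProofTerm L) : ProofTerm L
  | triv : ProofTerm L
  | botElim (p : ProofTerm L) : ProofTerm L
  | tlam (s : L.Srt) (p : ProofTerm L) : ProofTerm L
  | tapp {s : L.Srt} (p : ProofTerm L) (t : Term L s) : ProofTerm L
  | tpair {s : L.Srt} (t : Term L s) (p : ProofTerm L) : ProofTerm L
  | exElim (s : L.Srt) (p q : ProofTerm L) : ProofTerm L

namespace ProofTerm

variable {L : Language.{u}}

/-- Substitution of terms for the term variables of a proof-term. -/
noncomputable def tsubst : ((s : L.Srt) → ℕ → Term L s) → ProofTerm L → ProofTerm L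
  | _, var n => var n
  | σ, lam p => lam (p.tsubst σ)
  | σ, app p q => app (p.tsubst σ) (q.tsubst σ)
  | σ, pair p q => pair (p.tsubst σ) (q.tsubst σ)
  | σ, fst p => fst (p.tsubst σ)
  | σ, snd p => snd (p.tsubst σ)
  | σ, inl p => inl (p.tsubst σ)
  | σ, inr p => inr (p.tsubst σ)
  | σ, orElim p q r => orElim (p.tsubst σ) (q.tsubst σ) (r.tsubst σ)
  | _, triv => triv
  | σ, botElim p => botElim (p.tsubst σ)
  | σ, tlam s p => tlam s (p.tsubst (lift s σ))
  | σ, tapp p t => tapp (p.tsubst σ) (t.subst σ)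
  | σ, tpair t p => tpair (t.subst σ) (p.tsubst σ)
  | σ, exElim s p q => exElim s (p.tsubst σ) (q.tsubst (lift s σ))

/-- The renaming `ρ` of proof variables, moved under a binder for a proof variable. -/
def liftRen (ρ : ℕ → ℕ) : ℕ → ℕ :=
  fun n => Nat.casesOn n 0 (fun m => ρ m + 1)

/-- Renaming of the proof variables of a proof-term. -/
def rename : (ℕ → ℕ) → ProofTerm L → ProofTerm L
  | ρ, var n => var (ρ n)
  | ρ, lam p => lam (p.rename (liftRen ρ))
  | ρ, app p q => app (p.rename ρ) (q.rename ρ)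
  | ρ, pair p q => pair (p.rename ρ) (q.rename ρ)
  | ρ, fst p => fst (p.rename ρ)
  | ρ, snd p => snd (p.rename ρ)
  | ρ, inl p => inl (p.rename ρ)
  | ρ, inr p => inr (p.rename ρ)
  | ρ, orElim p q r => orElim (p.rename ρ) (q.rename (liftRen ρ)) (r.rename (liftRen ρ))
  | _, triv => triv
  | ρ, botElim p => botElim (p.rename ρ)
  | ρ, tlam s p => tlam s (p.rename ρ)
  | ρ, tapp p t => tapp (p.rename ρ) t
  | ρ, tpair t p => tpair t (p.rename ρ)
  | ρ, exElim s p q => exElim s (p.rename ρ) (q.rename (liftRen ρ))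

/-- The substitution `τ` for proof variables, moved under a binder for a proof variable. -/
def liftSub (τ : ℕ → ProofTerm L) : ℕ → ProofTerm L :=
  fun n => Nat.casesOn n (var 0) (fun m => (τ m).rename Nat.succ)

/-- The substitution `τ` for proof variables, moved under a binder for a term variable of
sort `s`. -/
noncomputable def tliftSub (s : L.Srt) (τ : ℕ → ProofTerm L) : ℕ → ProofTerm L :=
  fun n => (τ n).tsubst (shift s)

/-- Substitution of proof-terms for the proof variables of a proof-term. -/
noncomputable def subst : (ℕ → ProofTerm L) → ProofTerm L → ProofTerm L
  | τ, var n => τ n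
  | τ, lam p => lam (p.subst (liftSub τ))
  | τ, app p q => app (p.subst τ) (q.subst τ)
  | τ, pair p q => pair (p.subst τ) (q.subst τ)
  | τ, fst p => fst (p.subst τ)
  | τ, snd p => snd (p.subst τ)
  | τ, inl p => inl (p.subst τ)
  | τ, inr p => inr (p.subst τ)
  | τ, orElim p q r => orElim (p.subst τ) (q.subst (liftSub τ)) (r.subst (liftSub τ))
  | _, triv => triv
  | τ, botElim p => botElim (p.subst τ)
  | τ, tlam s p => tlam s (p.subst (tliftSub s τ))
  | τ, tapp p t => tapp (p.subst τ) t
  | τ, tpair t p => tpair t (p.subst τ)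
  | τ, exElim s p q => exElim s (p.subst τ) (q.subst (liftSub (tliftSub s τ)))

/-- `(q / α) p`, where `α` is the variable `var 0` of `p`, the binder of which is removed. -/
noncomputable def inst (p q : ProofTerm L) : ProofTerm L :=
  p.subst (fun n => Nat.casesOn n q var)

/-- `(t / x) p`, where `x` is the variable of index `0` and sort `s` of `p`, the binder of which is
removed. -/
noncomputable def tinst {s : L.Srt} (p : ProofTerm L) (t : Term L s) : ProofTerm L :=
  p.tsubst (single t)

/-- One-step proof reduction: the seven rules of cut elimination, applied at any place. -/
inductive Step : ProofTerm L → ProofTerm L → Prop where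
  | beta (p q : ProofTerm L) : Step (app (lam p) q) (p.inst q)
  | fst_pair (p q : ProofTerm L) : Step (fst (pair p q)) p
  | snd_pair (p q : ProofTerm L) : Step (snd (pair p q)) q
  | orElim_inl (p q r : ProofTerm L) : Step (orElim (inl p) q r) (q.inst p)
  | orElim_inr (p q r : ProofTerm L) : Step (orElim (inr p) q r) (r.inst p)
  | tbeta {s : L.Srt} (p : ProofTerm L) (t : Term L s) : Step (tapp (tlam s p) t) (p.tinst t)
  | exElim_tpair {s : L.Srt} (t : Term L s) (p q : ProofTerm L) :
      Step (exElim s (tpair t p) q) ((q.tinst t).inst p)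
  | lam {p p' : ProofTerm L} : Step p p' → Step (lam p) (lam p')
  | app_left {p p' : ProofTerm L} (q : ProofTerm L) : Step p p' → Step (app p q) (app p' q)
  | app_right (p : ProofTerm L) {q q' : ProofTerm L} : Step q q' → Step (app p q) (app p q')
  | pair_left {p p' : ProofTerm L} (q : ProofTerm L) : Step p p' → Step (pair p q) (pair p' q)
  | pair_right (p : ProofTerm L) {q q' : ProofTerm L} : Step q q' → Step (pair p q) (pair p q')
  | fst {p p' : ProofTerm L} : Step p p' → Step (fst p) (fst p')
  | snd {p p' : ProofTerm L} : Step p p' → Step (snd p) (snd p')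
  | inl {p p' : ProofTerm L} : Step p p' → Step (inl p) (inl p')
  | inr {p p' : ProofTerm L} : Step p p' → Step (inr p) (inr p')
  | orElim_one {p p' : ProofTerm L} (q r : ProofTerm L) :
      Step p p' → Step (orElim p q r) (orElim p' q r)
  | orElim_two (p : ProofTerm L) {q q' : ProofTerm L} (r : ProofTerm L) :
      Step q q' → Step (orElim p q r) (orElim p q' r)
  | orElim_three (p q : ProofTerm L) {r r' : ProofTerm L} :
      Step r r' → Step (orElim p q r) (orElim p q r')
  | botElim {p p' : ProofTerm L} : Step p p' → Step (botElim p) (botElim p')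
  | tlam (s : L.Srt) {p p' : ProofTerm L} : Step p p' → Step (tlam s p) (tlam s p')
  | tapp {s : L.Srt} {p p' : ProofTerm L} (t : Term L s) : Step p p' → Step (tapp p t) (tapp p' t)
  | tpair {s : L.Srt} (t : Term L s) {p p' : ProofTerm L} :
      Step p p' → Step (tpair t p) (tpair t p')
  | exElim_left (s : L.Srt) {p p' : ProofTerm L} (q : ProofTerm L) :
      Step p p' → Step (exElim s p q) (exElim s p' q)
  | exElim_right (s : L.Srt) (p : ProofTerm L) {q q' : ProofTerm L} :
      Step q q' → Step (exElim s p q) (exElim s p q')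

/-- A proof-term is strongly normalizing if all reduction sequences issued from it are finite. -/
def StronglyNormalizing (p : ProofTerm L) : Prop :=
  ¬ ∃ f : ℕ → ProofTerm L, f 0 = p ∧ ∀ n, Step (f n) (f (n + 1))

end ProofTerm

/-! ## Natural deduction modulo -/

namespace Theory

variable {L : Language.{u}}

/-- `T.Proves Γ p A`: the proof-term `p` is a proof of the sequent `Γ ⊢ A` in intuitionistic natural
deduction modulo the congruence of `T`. The proof variable `var n` stands for the `n`-th hypothesis
of `Γ`. Hypotheses are axioms of the theory or other assumptions. The condition that `x` does not
occur free in `Γ` (and in the conclusion) is expressed by shifting these formulae. -/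
inductive Proves (T : Theory L) : List (Formula L) → ProofTerm L → Formula L → Prop where
  | ax {Γ : List (Formula L)} {n : ℕ} {A B : Formula L} :
      Γ[n]? = some A → T.FormulaEquiv A B → Proves T Γ (.var n) B
  | imp_intro {Γ : List (Formula L)} {p : ProofTerm L} {A B C : Formula L} :
      Proves T (A :: Γ) p B → T.FormulaEquiv C (.imp A B) → Proves T Γ (.lam p) C
  | imp_elim {Γ : List (Formula L)} {p q : ProofTerm L} {A B C : Formula L} :
      Proves T Γ p C → Proves T Γ q A → T.FormulaEquiv C (.imp A B) → Proves T Γ (.app p q) B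
  | and_intro {Γ : List (Formula L)} {p q : ProofTerm L} {A B C : Formula L} :
      Proves T Γ p A → Proves T Γ q B → T.FormulaEquiv C (.and A B) → Proves T Γ (.pair p q) C
  | and_left {Γ : List (Formula L)} {p : ProofTerm L} {A B C : Formula L} :
      Proves T Γ p C → T.FormulaEquiv C (.and A B) → Proves T Γ (.fst p) A
  | and_right {Γ : List (Formula L)} {p : ProofTerm L} {A B C : Formula L} :
      Proves T Γ p C → T.FormulaEquiv C (.and A B) → Proves T Γ (.snd p) B
  | or_left {Γ : List (Formula L)} {p : ProofTerm L} {A B C : Formula L} :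
      Proves T Γ p A → T.FormulaEquiv C (.or A B) → Proves T Γ (.inl p) C
  | or_right {Γ : List (Formula L)} {p : ProofTerm L} {A B C : Formula L} :
      Proves T Γ p B → T.FormulaEquiv C (.or A B) → Proves T Γ (.inr p) C
  | or_elim {Γ : List (Formula L)} {p q r : ProofTerm L} {A B C D : Formula L} :
      Proves T Γ p D → T.FormulaEquiv D (.or A B) → Proves T (A :: Γ) q C →
      Proves T (B :: Γ) r C → Proves T Γ (.orElim p q r) C
  | top_intro {Γ : List (Formula L)} {A : Formula L} :
      T.FormulaEquiv A .top → Proves T Γ .triv A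
  | bot_elim {Γ : List (Formula L)} {p : ProofTerm L} {A B : Formula L} :
      Proves T Γ p B → T.FormulaEquiv B .bot → Proves T Γ (.botElim p) A
  | all_intro {Γ : List (Formula L)} {s : L.Srt} {p : ProofTerm L} {A B : Formula L} :
      Proves T (Γ.map (Formula.subst (shift s))) p A → T.FormulaEquiv B (.all s A) →
      Proves T Γ (.tlam s p) B
  | all_elim {Γ : List (Formula L)} {s : L.Srt} {p : ProofTerm L} {t : Term L s}
      {A B C : Formula L} :
      Proves T Γ p B → T.FormulaEquiv B (.all s A) → T.FormulaEquiv C (A.subst (single t)) →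
      Proves T Γ (.tapp p t) C
  | ex_intro {Γ : List (Formula L)} {s : L.Srt} {p : ProofTerm L} {t : Term L s}
      {A B C : Formula L} :
      Proves T Γ p C → T.FormulaEquiv B (.ex s A) → T.FormulaEquiv C (A.subst (single t)) →
      Proves T Γ (.tpair t p) B
  | ex_elim {Γ : List (Formula L)} {s : L.Srt} {p q : ProofTerm L} {A B C : Formula L} :
      Proves T Γ p C → T.FormulaEquiv C (.ex s A) →
      Proves T (A :: Γ.map (Formula.subst (shift s))) q (B.subst (shift s)) →
      Proves T Γ (.exElim s p q) B

end Theory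

end DeductionModulo

/-! The proof is Tait and Girard's reducibility method, arranged so that reducibility is a
denotation. The reducibility candidates, ordered by inclusion, form a full, ordered and complete
truth values algebra. Every candidate contains the proof variables, so all truth values can be
declared positive and the deduction conditions become trivial. Super-consistency then provides a
model valued in this algebra. In this model congruent formulae denote the same candidate, so the
conversion steps of deduction modulo cost nothing.

It remains to prove adequacy (`Theory.Proves.mem_denote`): a proof of `A`, with members of the
denotations of its hypotheses substituted for its proof variables, belongs to the denotation of `A`.
This goes by induction on the derivation, with one lemma on candidates per introduction or
elimination rule (`lam_mem`, `app_mem`, and so on). The substitution of terms and the assignment of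
domain elements are independent in this statement, because the algebra sees the set of truth values
of the instances of a quantified formula and not the elements they come from. Taking identity
substitutions puts each proof in a candidate, hence among the strongly normalizing proof-terms. -/

namespace DeductionModulo

/-! ### Substitution of terms in de Bruijn form. -/

section SubstitutionCalculus

variable {L : Language.{u}}

@[simp]
theorem cons_zero {F : L.Srt → Type v} {s : L.Srt} (a : F s) (φ : (s : L.Srt) → ℕ → F s) :
    cons a φ s 0 = a := by
  simp [cons]

@[simp]
theorem cons_succ {F : L.Srt → Type v} {s : L.Srt} (a : F s) (φ : (s : L.Srt) → ℕ → F s) (n : ℕ) :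
    cons a φ s (n + 1) = φ s n := by
  simp [cons]

theorem cons_of_ne {F : L.Srt → Type v} {s r : L.Srt} (a : F s) (φ : (s : L.Srt) → ℕ → F s)
    (h : r ≠ s) : cons a φ r = φ r := by
  simp [cons, h]

/-- Two families of values agree if they agree on `var s 0` and on all shifted variables. -/
theorem family_ext {F : L.Srt → Type v} (s : L.Srt) {φ ψ : (s : L.Srt) → ℕ → F s}
    (h0 : φ s 0 = ψ s 0) (hs : ∀ n, φ s (n + 1) = ψ s (n + 1)) (hr : ∀ r ≠ s, ∀ n, φ r n = ψ r n) :
    φ = ψ := by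
  funext r n
  by_cases h : r = s
  · subst h
    cases n with
    | zero => exact h0
    | succ n => exact hs n
  · exact hr r h n

@[simp]
theorem shift_same (s : L.Srt) (n : ℕ) : shift s s n = Term.var s (n + 1) := by
  simp [shift]

theorem shift_of_ne {s r : L.Srt} (h : r ≠ s) (n : ℕ) : shift s r n = Term.var r n := by
  simp [shift, h]

theorem Term.subst_subst (σ τ : (s : L.Srt) → ℕ → Term L s) {s : L.Srt} (t : Term L s) :
    (t.subst σ).subst τ = t.subst (fun r n => (σ r n).subst τ) := by
  induction t with
  | var s n => rfl
  | app f ts ih => simp only [Term.subst, ih]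

theorem Term.subst_var {s : L.Srt} (t : Term L s) : t.subst Term.var = t := by
  induction t with
  | var s n => rfl
  | app f ts ih => simp only [Term.subst, ih]

theorem shift_subst_cons (s : L.Srt) (t : Term L s) (σ : (s : L.Srt) → ℕ → Term L s) :
    (fun r n => (shift s r n).subst (cons (F := Term L) t σ)) = σ := by
  funext r n
  by_cases h : r = s
  · subst h
    simp [Term.subst]
  · simp [shift_of_ne h, Term.subst, cons_of_ne _ _ h]

/-- The shift inside `lift` is cancelled by `cons`. Since `lift s τ` and `single t` are themselves
of the form `cons`, the laws `lift_subst_lift` and `lift_subst_single` are instances. -/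
theorem lift_subst_cons (s : L.Srt) (t : Term L s) (σ τ : (s : L.Srt) → ℕ → Term L s) :
    (fun r n => (lift s σ r n).subst (cons (F := Term L) t τ)) =
      cons (F := Term L) t (fun r n => (σ r n).subst τ) := by
  apply family_ext s
  · simp [lift, Term.subst]
  · intro n
    simp [lift, Term.subst_subst, shift_subst_cons]
  · intro r h n
    simp [lift, cons_of_ne _ _ h, Term.subst_subst, shift_subst_cons]

theorem lift_subst_lift (s : L.Srt) (σ τ : (s : L.Srt) → ℕ → Term L s) :
    (fun r n => (lift s σ r n).subst (lift s τ)) = lift s (fun r n => (σ r n).subst τ) := by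
  rw [lift.eq_def s τ, lift_subst_cons]
  simp only [lift, Term.subst_subst]

theorem shift_subst_lift (s : L.Srt) (σ : (s : L.Srt) → ℕ → Term L s) :
    (fun r n => (shift s r n).subst (lift s σ)) = fun r n => (σ r n).subst (shift s) :=
  shift_subst_cons s _ _

theorem lift_var (s : L.Srt) : lift s Term.var = (Term.var : (r : L.Srt) → ℕ → Term L r) := by
  apply family_ext s
  · simp [lift]
  · intro n
    simp [lift, Term.subst]
  · intro r h n
    simp [lift, cons_of_ne _ _ h, Term.subst, shift_of_ne h]

theorem lift_subst_single (s : L.Srt) (t : Term L s) (σ : (s : L.Srt) → ℕ → Term L s) :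
    (fun r n => (lift s σ r n).subst (single t)) = cons (F := Term L) t σ := by
  simp only [single, lift_subst_cons, Term.subst_var]

theorem single_subst (s : L.Srt) (t : Term L s) (σ : (s : L.Srt) → ℕ → Term L s) :
    (fun r n => (single t r n).subst σ) = cons (F := Term L) (t.subst σ) σ := by
  apply family_ext s
  · simp [single]
  · intro n
    simp [single, Term.subst]
  · intro r h n
    simp [single, cons_of_ne _ _ h, Term.subst]

end SubstitutionCalculus

/-! ### Denotations under substitution. -/

namespace ValuedStructure

variable {L : Language.{u}} {B : Type u} (M : ValuedStructure.{u, v} L B)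

theorem termDenote_subst (φ : M.Assignment) (σ : (s : L.Srt) → ℕ → Term L s) {s : L.Srt}
    (t : Term L s) :
    M.termDenote φ (t.subst σ) = M.termDenote (fun r n => M.termDenote φ (σ r n)) t := by
  induction t with
  | var s n => rfl
  | app f ts ih => simp only [Term.subst, termDenote, ih]

theorem termDenote_shift {s : L.Srt} (e : M.Dom s) (φ : M.Assignment) :
    (fun r n => M.termDenote (cons (F := M.Dom) e φ) (shift s r n)) = φ := by
  funext r n
  by_cases h : r = s
  · subst h
    simp [termDenote]
  · simp [shift_of_ne h, termDenote, cons_of_ne _ _ h]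

theorem termDenote_lift {s : L.Srt} (e : M.Dom s) (φ : M.Assignment)
    (σ : (s : L.Srt) → ℕ → Term L s) :
    (fun r n => M.termDenote (cons (F := M.Dom) e φ) (lift s σ r n)) =
      cons (F := M.Dom) e (fun r n => M.termDenote φ (σ r n)) := by
  apply family_ext s
  · simp [lift, termDenote]
  · intro n
    simp [lift, termDenote_subst, termDenote_shift]
  · intro r h n
    simp [lift, cons_of_ne _ _ h, termDenote_subst, termDenote_shift]

theorem termDenote_single {s : L.Srt} (t : Term L s) (φ : M.Assignment) :
    (fun r n => M.termDenote φ (single t r n)) = cons (F := M.Dom) (M.termDenote φ t) φ := by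
  apply family_ext s
  · simp [single]
  · intro n
    simp [single, termDenote]
  · intro r h n
    simp [single, cons_of_ne _ _ h, termDenote]

theorem denote_subst (𝔹 : TruthValuesAlgebra B) (h : 𝔹.IsFull) (A : Formula L)
    (φ : M.Assignment) (σ : (s : L.Srt) → ℕ → Term L s) :
    M.denote 𝔹 h φ (A.subst σ) = M.denote 𝔹 h (fun r n => M.termDenote φ (σ r n)) A := by
  induction A generalizing φ σ with
  | atom P ts => simp only [Formula.subst, denote, termDenote_subst]
  | top => rfl
  | bot => rfl
  | imp A C ihA ihC => simp only [Formula.subst, denote, ihA, ihC]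
  | and A C ihA ihC => simp only [Formula.subst, denote, ihA, ihC]
  | or A C ihA ihC => simp only [Formula.subst, denote, ihA, ihC]
  | all s A ih => simp only [Formula.subst, denote, ih, termDenote_lift]
  | ex s A ih => simp only [Formula.subst, denote, ih, termDenote_lift]

/-- The semantic form of the eigenvariable condition of `all_intro` and `ex_elim`. -/
theorem denote_shift (𝔹 : TruthValuesAlgebra B) (h : 𝔹.IsFull) (A : Formula L)
    (φ : M.Assignment) {s : L.Srt} (e : M.Dom s) :
    M.denote 𝔹 h (cons (F := M.Dom) e φ) (A.subst (shift s)) = M.denote 𝔹 h φ A := by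
  rw [denote_subst, termDenote_shift]

theorem denote_single (𝔹 : TruthValuesAlgebra B) (h : 𝔹.IsFull) (A : Formula L)
    (φ : M.Assignment) {s : L.Srt} (t : Term L s) :
    M.denote 𝔹 h φ (A.subst (single t)) =
      M.denote 𝔹 h (cons (F := M.Dom) (M.termDenote φ t) φ) A := by
  rw [denote_subst, termDenote_single]

end ValuedStructure

/-! ### Substitution of terms and of proof-terms in proof-terms. -/

namespace ProofTerm

variable {L : Language.{u}}

/-- The substitution that gives `q` to `var 0` and `τ n` to `var (n + 1)`. -/
def scons (q : ProofTerm L) (τ : ℕ → ProofTerm L) : ℕ → ProofTerm L :=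
  fun n => Nat.casesOn n q τ

theorem tsubst_tsubst (p : ProofTerm L) (σ τ : (s : L.Srt) → ℕ → Term L s) :
    (p.tsubst σ).tsubst τ = p.tsubst (fun r n => (σ r n).subst τ) := by
  induction p generalizing σ τ <;> simp_all [tsubst, Term.subst_subst, lift_subst_lift]

theorem tsubst_var (p : ProofTerm L) : p.tsubst Term.var = p := by
  induction p <;> simp_all [tsubst, Term.subst_var, lift_var]

theorem tsubst_rename (p : ProofTerm L) (ρ : ℕ → ℕ) (σ : (s : L.Srt) → ℕ → Term L s) :
    (p.rename ρ).tsubst σ = (p.tsubst σ).rename ρ := by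
  induction p generalizing ρ σ <;> simp_all [tsubst, rename]

theorem liftRen_comp (ρ ρ' : ℕ → ℕ) :
    (fun n => liftRen ρ' (liftRen ρ n)) = liftRen (fun n => ρ' (ρ n)) := by
  funext n
  cases n <;> rfl

theorem rename_rename (p : ProofTerm L) (ρ ρ' : ℕ → ℕ) :
    (p.rename ρ).rename ρ' = p.rename (fun n => ρ' (ρ n)) := by
  induction p generalizing ρ ρ' <;> simp_all [rename, liftRen_comp]

theorem liftSub_liftRen (ρ : ℕ → ℕ) (τ : ℕ → ProofTerm L) :
    (fun n => liftSub τ (liftRen ρ n)) = liftSub (fun n => τ (ρ n)) := by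
  funext n
  cases n <;> rfl

theorem tliftSub_comp_ren (s : L.Srt) (ρ : ℕ → ℕ) (τ : ℕ → ProofTerm L) :
    (fun n => tliftSub s τ (ρ n)) = tliftSub s (fun n => τ (ρ n)) := rfl

theorem subst_rename (p : ProofTerm L) (ρ : ℕ → ℕ) (τ : ℕ → ProofTerm L) :
    (p.rename ρ).subst τ = p.subst (fun n => τ (ρ n)) := by
  induction p generalizing ρ τ <;>
    simp_all [rename, subst, liftSub_liftRen, tliftSub_comp_ren]

theorem rename_liftSub (τ : ℕ → ProofTerm L) (ρ : ℕ → ℕ) :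
    (fun n => (liftSub τ n).rename (liftRen ρ)) = liftSub (fun n => (τ n).rename ρ) := by
  funext n
  cases n with
  | zero => rfl
  | succ n => simp [liftSub, rename_rename, liftRen]

theorem rename_tliftSub (s : L.Srt) (τ : ℕ → ProofTerm L) (ρ : ℕ → ℕ) :
    (fun n => (tliftSub s τ n).rename ρ) = tliftSub s (fun n => (τ n).rename ρ) := by
  funext n
  simp only [tliftSub, tsubst_rename]

theorem rename_subst (p : ProofTerm L) (τ : ℕ → ProofTerm L) (ρ : ℕ → ℕ) :
    (p.subst τ).rename ρ = p.subst (fun n => (τ n).rename ρ) := by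
  induction p generalizing ρ τ <;>
    simp_all [rename, subst, rename_liftSub, rename_tliftSub]

theorem tsubst_liftSub (τ : ℕ → ProofTerm L) (σ : (s : L.Srt) → ℕ → Term L s) :
    (fun n => (liftSub τ n).tsubst σ) = liftSub (fun n => (τ n).tsubst σ) := by
  funext n
  cases n with
  | zero => rfl
  | succ n => simp [liftSub, tsubst_rename]

theorem tsubst_tliftSub (s : L.Srt) (τ : ℕ → ProofTerm L) (σ : (s : L.Srt) → ℕ → Term L s) :
    (fun n => (tliftSub s τ n).tsubst (lift s σ)) = tliftSub s (fun n => (τ n).tsubst σ) := by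
  funext n
  simp only [tliftSub, tsubst_tsubst, shift_subst_lift]

theorem tsubst_subst (p : ProofTerm L) (τ : ℕ → ProofTerm L) (σ : (s : L.Srt) → ℕ → Term L s) :
    (p.subst τ).tsubst σ = (p.tsubst σ).subst (fun n => (τ n).tsubst σ) := by
  induction p generalizing σ τ <;>
    simp_all [tsubst, subst, tsubst_liftSub, tsubst_tliftSub]

theorem subst_liftSub_scons (τ τ' : ℕ → ProofTerm L) (q : ProofTerm L) :
    (fun n => (liftSub τ n).subst (scons q τ')) = scons q (fun n => (τ n).subst τ') := by
  funext n
  cases n with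
  | zero => rfl
  | succ n => simp [liftSub, subst_rename, scons]

theorem subst_liftSub (τ τ' : ℕ → ProofTerm L) :
    (fun n => (liftSub τ n).subst (liftSub τ')) = liftSub (fun n => (τ n).subst τ') := by
  funext n
  cases n with
  | zero => rfl
  | succ n => simp [liftSub, subst_rename, rename_subst]

theorem subst_tliftSub (s : L.Srt) (τ τ' : ℕ → ProofTerm L) :
    (fun n => (tliftSub s τ n).subst (tliftSub s τ')) = tliftSub s (fun n => (τ n).subst τ') := by
  funext n
  simp only [tliftSub, tsubst_subst]
  rfl

/-- Under a proof binder a substitution is renamed, and under a term binder it undergoes `tsubst`.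
The induction therefore rests on the commutations `subst_rename`, `rename_subst` and `tsubst_subst`.
-/
theorem subst_subst (p : ProofTerm L) (τ τ' : ℕ → ProofTerm L) :
    (p.subst τ).subst τ' = p.subst (fun n => (τ n).subst τ') := by
  induction p generalizing τ τ' <;>
    simp_all [subst, subst_liftSub, subst_tliftSub]

theorem liftSub_var : liftSub (var : ℕ → ProofTerm L) = var := by
  funext n
  cases n <;> rfl

theorem tliftSub_var (s : L.Srt) : tliftSub s (var : ℕ → ProofTerm L) = var := rfl

theorem subst_var (p : ProofTerm L) : p.subst var = p := by
  induction p <;> simp_all [subst, liftSub_var, tliftSub_var]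

theorem inst_eq (p q : ProofTerm L) : p.inst q = p.subst (scons q var) := rfl

theorem subst_scons_var (q : ProofTerm L) (τ : ℕ → ProofTerm L) :
    (fun n => (scons q var n).subst τ) = scons (q.subst τ) τ := by
  funext n
  cases n <;> rfl

/-- Adequacy uses this form: contracting a cut under a substitution yields one simultaneous
substitution, to which the induction hypothesis for the longer context applies. -/
theorem inst_subst_liftSub (p q : ProofTerm L) (τ : ℕ → ProofTerm L) :
    (p.subst (liftSub τ)).inst q = p.subst (scons q τ) := by
  simp only [inst_eq, subst_subst, subst_liftSub_scons, subst_var]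

theorem inst_subst (p q : ProofTerm L) (τ : ℕ → ProofTerm L) :
    (p.subst (liftSub τ)).inst (q.subst τ) = (p.inst q).subst τ := by
  rw [inst_subst_liftSub, inst_eq, subst_subst, subst_scons_var]

theorem tsubst_tliftSub_single {s : L.Srt} (t : Term L s) (τ : ℕ → ProofTerm L) :
    (fun n => (tliftSub s τ n).tsubst (single t)) = τ := by
  simp only [tliftSub, tsubst_tsubst, single, shift_subst_cons, tsubst_var]

theorem tinst_subst {s : L.Srt} (p : ProofTerm L) (t : Term L s) (τ : ℕ → ProofTerm L) :
    (p.subst (tliftSub s τ)).tinst t = (p.tinst t).subst τ := by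
  simp only [tinst, tsubst_subst, tsubst_tliftSub_single]

theorem tinst_subst_liftSub {s : L.Srt} (p : ProofTerm L) (t : Term L s) (τ : ℕ → ProofTerm L) :
    (p.subst (liftSub (tliftSub s τ))).tinst t = (p.tinst t).subst (liftSub τ) := by
  simp only [tinst, tsubst_subst, tsubst_liftSub, tsubst_tliftSub_single]

theorem inst_tsubst (p q : ProofTerm L) (σ : (s : L.Srt) → ℕ → Term L s) :
    (p.inst q).tsubst σ = (p.tsubst σ).inst (q.tsubst σ) := by
  simp only [inst_eq, tsubst_subst]
  congr 1
  funext n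
  cases n <;> rfl

theorem tinst_lift {s : L.Srt} (p : ProofTerm L) (t : Term L s)
    (σ : (s : L.Srt) → ℕ → Term L s) :
    (p.tsubst (lift s σ)).tinst t = p.tsubst (cons (F := Term L) t σ) := by
  simp only [tinst, tsubst_tsubst, lift_subst_single]

theorem tinst_tsubst {s : L.Srt} (p : ProofTerm L) (t : Term L s)
    (σ : (s : L.Srt) → ℕ → Term L s) :
    (p.tinst t).tsubst σ = (p.tsubst (lift s σ)).tinst (t.subst σ) := by
  rw [tinst_lift, tinst, tsubst_tsubst, single_subst]

/-- Exactly one step is mapped to one step, never to zero, so infinite reductions are preserved by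
instantiation; `SN.of_inst` depends on this. -/
theorem Step.subst {p p' : ProofTerm L} (h : Step p p') (τ : ℕ → ProofTerm L) :
    Step (p.subst τ) (p'.subst τ) := by
  induction h generalizing τ with
  | beta p q => rw [← inst_subst]; exact .beta _ _
  | orElim_inl p q r => rw [← inst_subst]; exact .orElim_inl _ _ _
  | orElim_inr p q r => rw [← inst_subst]; exact .orElim_inr _ _ _
  | tbeta p t => rw [← tinst_subst]; exact .tbeta _ _
  | exElim_tpair t p q =>
    rw [← inst_subst, ← tinst_subst_liftSub]; exact .exElim_tpair _ _ _
  | _ => constructor <;> apply_assumption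

theorem Step.tsubst {p p' : ProofTerm L} (h : Step p p') (σ : (s : L.Srt) → ℕ → Term L s) :
    Step (p.tsubst σ) (p'.tsubst σ) := by
  induction h generalizing σ with
  | beta p q => rw [inst_tsubst]; exact .beta _ _
  | orElim_inl p q r => rw [inst_tsubst]; exact .orElim_inl _ _ _
  | orElim_inr p q r => rw [inst_tsubst]; exact .orElim_inr _ _ _
  | tbeta p t => rw [tinst_tsubst]; exact .tbeta _ _
  | exElim_tpair t p q => rw [inst_tsubst, tinst_tsubst]; exact .exElim_tpair _ _ _
  | _ => constructor <;> apply_assumption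

end ProofTerm

end DeductionModulo

namespace DeductionModulo

namespace ProofTerm

variable {L : Language.{u}}

/-! ## Strong normalization as accessibility -/

/-- Accessibility for proof reduction. -/
def SN (p : ProofTerm L) : Prop :=
  Acc (fun q p => Step p q) p

theorem SN.step {p p' : ProofTerm L} (h : SN p) (hs : Step p p') : SN p' :=
  h.inv hs

theorem SN.stronglyNormalizing {p : ProofTerm L} (h : SN p) : p.StronglyNormalizing := by
  induction h with
  | intro p _ ih =>
    rintro ⟨f, rfl, hf⟩
    exact ih (f 1) (hf 0) ⟨fun n => f (n + 1), rfl, fun n => hf (n + 1)⟩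

/-- A proof-term is strongly normalizing if its image by a map that preserves reduction is. -/
theorem SN.of_map (F : ProofTerm L → ProofTerm L)
    (hF : ∀ p p', Step p p' → Step (F p) (F p')) {p : ProofTerm L} (h : SN (F p)) : SN p :=
  Subrelation.accessible (fun {q p} hqp => hF p q hqp) (InvImage.accessible F h)

/-- Candidates only speak of instances of a body under a binder. Strong normalization of the body
itself is recovered from any single instance. -/
theorem SN.of_inst {p q : ProofTerm L} (h : SN (p.inst q)) : SN p :=
  SN.of_map (fun p => p.inst q) (fun _ _ hs => hs.subst _) h

theorem SN.of_tinst {s : L.Srt} {p : ProofTerm L} {t : Term L s} (h : SN (p.tinst t)) : SN p :=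
  SN.of_map (fun p => p.tinst t) (fun _ _ hs => hs.tsubst _) h

/-- Reduction in any number of steps. -/
abbrev Steps : ProofTerm L → ProofTerm L → Prop :=
  Relation.ReflTransGen Step

/-- The unary constructor `F` cannot be at the root of a redex. -/
def IsRigid (F : ProofTerm L → ProofTerm L) : Prop :=
  ∀ p r, Step (F p) r → ∃ p', r = F p' ∧ Step p p'

theorem isRigid_lam : IsRigid (lam : ProofTerm L → ProofTerm L) := by
  intro p r h
  cases h with
  | lam h => exact ⟨_, rfl, h⟩

theorem isRigid_inl : IsRigid (inl : ProofTerm L → ProofTerm L) := by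
  intro p r h
  cases h with
  | inl h => exact ⟨_, rfl, h⟩

theorem isRigid_inr : IsRigid (inr : ProofTerm L → ProofTerm L) := by
  intro p r h
  cases h with
  | inr h => exact ⟨_, rfl, h⟩

theorem isRigid_tlam (s : L.Srt) : IsRigid (tlam s : ProofTerm L → ProofTerm L) := by
  intro p r h
  cases h with
  | tlam _ h => exact ⟨_, rfl, h⟩

theorem isRigid_tpair {s : L.Srt} (t : Term L s) : IsRigid (tpair t) := by
  intro p r h
  cases h with
  | tpair _ h => exact ⟨_, rfl, h⟩

theorem IsRigid.sn {F : ProofTerm L → ProofTerm L} (hF : IsRigid F) {p : ProofTerm L}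
    (h : SN p) : SN (F p) := by
  induction h with
  | intro p _ ih =>
    refine ⟨_, fun r hr => ?_⟩
    obtain ⟨p', rfl, hp'⟩ := hF p r hr
    exact ih p' hp'

theorem IsRigid.steps {F : ProofTerm L → ProofTerm L} (hF : IsRigid F) {p r : ProofTerm L}
    (h : Steps (F p) r) : ∃ p', r = F p' ∧ Steps p p' := by
  induction h with
  | refl => exact ⟨p, rfl, .refl⟩
  | tail _ hs ih =>
    obtain ⟨p', rfl, hp'⟩ := ih
    obtain ⟨p'', rfl, hp''⟩ := hF _ _ hs
    exact ⟨p'', rfl, hp'.tail hp''⟩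

theorem sn_pair {p q : ProofTerm L} (hp : SN p) (hq : SN q) : SN (pair p q) := by
  induction hp generalizing q with
  | intro p _ ihp =>
    induction hq with
    | intro q hq ihq =>
      refine ⟨_, fun r hr => ?_⟩
      cases hr with
      | pair_left _ h => exact ihp _ h ⟨_, hq⟩
      | pair_right _ h => exact ihq _ h

theorem steps_pair {p q r : ProofTerm L} (h : Steps (pair p q) r) :
    ∃ p' q', r = pair p' q' ∧ Steps p p' ∧ Steps q q' := by
  induction h with
  | refl => exact ⟨p, q, rfl, .refl, .refl⟩
  | tail _ hs ih =>
    obtain ⟨p', q', rfl, hp', hq'⟩ := ih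
    cases hs with
    | pair_left _ h => exact ⟨_, _, rfl, hp'.tail h, hq'⟩
    | pair_right _ h => exact ⟨_, _, rfl, hp', hq'.tail h⟩

/-! ## Reducibility candidates -/

/-- A proof-term is neutral if it is a variable or ends with an elimination. -/
def IsNeutral : ProofTerm L → Prop
  | lam _ | pair _ _ | inl _ | inr _ | triv | tlam _ _ | tpair _ _ => False
  | _ => True

/-- Reducibility candidates. -/
structure IsCandidate (R : Set (ProofTerm L)) : Prop where
  sn : ∀ p ∈ R, SN p
  step : ∀ p ∈ R, ∀ p', Step p p' → p' ∈ R
  neutral : ∀ p, p.IsNeutral → (∀ p', Step p p' → p' ∈ R) → p ∈ R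

theorem IsCandidate.steps {R : Set (ProofTerm L)} (hR : IsCandidate R) {p p' : ProofTerm L}
    (hp : p ∈ R) (h : Steps p p') : p' ∈ R := by
  induction h with
  | refl => exact hp
  | tail _ hs ih => exact hR.step _ ih _ hs

/-- A variable is neutral and has no reduct, so the premise of `neutral` is vacuous. -/
theorem IsCandidate.var_mem {R : Set (ProofTerm L)} (hR : IsCandidate R) (n : ℕ) : var n ∈ R :=
  hR.neutral _ trivial (fun _ h => nomatch h)

/-- The strongly normalizing proof-terms all the reducts of which satisfy `V`. -/
def hereditary (V : ProofTerm L → Prop) : Set (ProofTerm L) :=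
  {p | SN p ∧ ∀ p', Steps p p' → V p'}

/-- A reduct of a neutral proof-term is either itself, where `hV` applies, or a reduct of one of its
one-step reducts, where the premise applies. -/
theorem isCandidate_hereditary {V : ProofTerm L → Prop} (hV : ∀ p, p.IsNeutral → V p) :
    IsCandidate (hereditary V) where
  sn _ hp := hp.1
  step _ hp _ h := ⟨hp.1.step h, fun _ hr => hp.2 _ (.head h hr)⟩
  neutral p hn h := by
    refine ⟨⟨_, fun p' hp' => (h p' hp').1⟩, fun r hr => ?_⟩
    rcases hr.cases_head with rfl | ⟨p', hp', hr⟩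
    · exact hV _ hn
    · exact (h p' hp').2 r hr

theorem hereditary_mono {V W : ProofTerm L → Prop} (h : ∀ p, V p → W p) :
    hereditary V ⊆ hereditary W :=
  fun _ hp => ⟨hp.1, fun p' hp' => h _ (hp.2 p' hp')⟩

end ProofTerm

open ProofTerm

/-- The set of reducibility candidates, ordered by inclusion. -/
abbrev Candidate (L : Language.{u}) : Type u :=
  {R : Set (ProofTerm L) // IsCandidate R}

/-! ### The truth values algebra of candidates. -/

namespace Candidate

variable {L : Language.{u}}

/-- The greatest candidate: all strongly normalizing proof-terms. -/
def top : Candidate L :=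
  ⟨hereditary fun _ => True, isCandidate_hereditary fun _ _ => trivial⟩

theorem mem_top {p : ProofTerm L} (h : SN p) : p ∈ (top : Candidate L).1 :=
  ⟨h, fun _ _ => trivial⟩

/-- As for the other connectives, only the introductions reached by reduction are constrained.
Neutral proof-terms satisfy the condition vacuously, and monotonicity reduces to `hereditary_mono`.
-/
def imp (a b : Candidate L) : Candidate L :=
  ⟨hereditary fun p => ∀ p₁, p = .lam p₁ → ∀ q ∈ a.1, p₁.inst q ∈ b.1,
    isCandidate_hereditary (by rintro _ h p rfl; exact h.elim)⟩

def and (a b : Candidate L) : Candidate L :=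
  ⟨hereditary fun p => ∀ p₁ p₂, p = .pair p₁ p₂ → p₁ ∈ a.1 ∧ p₂ ∈ b.1,
    isCandidate_hereditary (by rintro _ h p q rfl; exact h.elim)⟩

def or (a b : Candidate L) : Candidate L :=
  ⟨hereditary fun p => (∀ p₁, p = .inl p₁ → p₁ ∈ a.1) ∧ ∀ p₂, p = .inr p₂ → p₂ ∈ b.1,
    isCandidate_hereditary (by
      intro _ h
      constructor <;> (rintro p rfl; exact h.elim))⟩

/-- The term `t` and the truth value `a` range independently, and so does the sort: the operation
receives only a set of truth values, so it cannot relate a term to the element it denotes. The same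
holds of the witness in `ex`. -/
def fa (A : Set (Candidate L)) : Candidate L :=
  ⟨hereditary fun p => ∀ s p₁, p = .tlam s p₁ → ∀ t : Term L s, ∀ a ∈ A, p₁.tinst t ∈ a.1,
    isCandidate_hereditary (by rintro _ h s p rfl; exact h.elim)⟩

def ex (E : Set (Candidate L)) : Candidate L :=
  ⟨hereditary fun p => ∀ s (t : Term L s) p₁, p = .tpair t p₁ → ∃ a ∈ E, p₁ ∈ a.1,
    isCandidate_hereditary (by rintro _ h s t p rfl; exact h.elim)⟩

/-- The intersection of a set of candidates. -/
def inf (X : Set (Candidate L)) : Candidate L :=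
  -- The conjunct `SN p` matters when `X` is empty; the bare intersection would then contain every
  -- proof-term.
  ⟨{p | SN p ∧ ∀ a ∈ X, p ∈ a.1},
    { sn := fun _ hp => hp.1
      step := fun _ hp _ h => ⟨hp.1.step h, fun a ha => a.2.step _ (hp.2 a ha) _ h⟩
      neutral := fun p hn h => ⟨⟨_, fun p' hp' => (h p' hp').1⟩,
        fun a ha => a.2.neutral p hn fun p' hp' => (h p' hp').2 a ha⟩ }⟩

theorem isCompleteOrder : IsCompleteOrder (Candidate L) := fun X =>
  ⟨inf X, fun a ha _ hp => hp.2 a ha, fun b hb p hp => ⟨b.2.sn p hp, fun _ ha => hb ha hp⟩⟩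

/-- The truth values algebra of reducibility candidates. All truth values are positive: each
candidate contains the variables. -/
def algebra (L : Language.{u}) : TruthValuesAlgebra (Candidate L) where
  pos := Set.univ
  AA := Set.univ
  EE := Set.univ
  top := top
  -- Absurdity has no introduction rule, so there is no reduct to constrain beyond strong
  -- normalization.
  bot := top
  imp := imp
  and := and
  or := or
  fa A _ := fa A
  ex E _ := ex E
  modus_ponens _ _ _ _ := trivial
  imp_k _ _ := trivial
  imp_s _ _ _ := trivial
  top_mem := trivial
  bot_elim _ := trivial
  and_intro _ _ := trivial
  and_left _ _ := trivial
  and_right _ _ := trivial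
  or_left _ _ := trivial
  or_right _ _ := trivial
  or_elim _ _ _ := trivial
  imp_set_mem _ _ _ := trivial
  set_imp_mem _ _ _ := trivial
  fa_intro _ _ _ := trivial
  fa_imp _ _ _ := trivial
  fa_elim _ _ _ _ := trivial
  ex_intro _ _ _ _ := trivial
  ex_elim _ _ _ := trivial

theorem algebra_isFull : (algebra L).IsFull :=
  ⟨rfl, rfl⟩

theorem algebra_isOrdered : (algebra L).IsOrdered where
  pos_upward _ _ _ _ := trivial
  top_maximal a _ _ hp := mem_top (a.2.sn _ hp)
  and_mono _ _ _ _ ha hb := hereditary_mono fun _ h p₁ p₂ e =>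
    ⟨ha (h p₁ p₂ e).1, hb (h p₁ p₂ e).2⟩
  or_mono _ _ _ _ ha hb := hereditary_mono fun _ h =>
    ⟨fun p₁ e => ha (h.1 p₁ e), fun p₂ e => hb (h.2 p₂ e)⟩
  imp_mono _ _ _ _ ha hb := hereditary_mono fun _ h p₁ e q hq => hb (h p₁ e q (ha hq))
  fa_mono _ _ _ _ hA := hereditary_mono fun _ h s p₁ e t b hb => by
    obtain ⟨a, ha, hab⟩ := hA b hb
    exact hab (h s p₁ e t a ha)
  ex_mono _ _ _ _ hE := hereditary_mono fun _ h s t p₁ e => by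
    obtain ⟨a, ha, hp⟩ := h s t p₁ e
    obtain ⟨b, hb, hab⟩ := hE a ha
    exact ⟨b, hb, hab hp⟩

/-! ### Introductions and eliminations -/

variable {p q r : ProofTerm L} {a b c : Candidate L} {A E : Set (Candidate L)}

theorem lam_mem (h : ∀ q ∈ a.1, p.inst q ∈ b.1) : .lam p ∈ (imp a b).1 := by
  -- The instance at a variable, which every candidate contains, gives strong normalization of the
  -- body.
  refine ⟨isRigid_lam.sn (b.2.sn _ (h _ (a.2.var_mem 0))).of_inst, ?_⟩
  rintro _ hr p' rfl q hq
  obtain ⟨p'', e, hp⟩ := isRigid_lam.steps hr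
  cases e
  exact b.2.steps (h q hq) (hp.lift (fun p => p.inst q) fun _ _ hs => hs.subst _)

/-- An elimination is neutral, so it suffices to treat its one-step reducts. Those inside a subterm
are handled by induction on accessibility, and the contraction at the root by the condition that
`hereditary` puts on introductions. The other eliminations follow this pattern. -/
theorem app_mem (hp : p ∈ (imp a b).1) (hq : q ∈ a.1) : .app p q ∈ b.1 := by
  have sp := hp.1
  have sq := a.2.sn q hq
  induction sp generalizing q with
  | intro p _ ihp =>
    induction sq with
    | intro q sq ihq =>
      refine b.2.neutral _ trivial fun r hr => ?_
      cases hr with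
      | beta p₁ _ => exact hp.2 _ .refl p₁ rfl q hq
      | app_left _ h => exact ihp _ h ((imp a b).2.step _ hp _ h) hq ⟨_, sq⟩
      | app_right _ h => exact ihq _ h (a.2.step _ hq _ h)

theorem pair_mem (hp : p ∈ a.1) (hq : q ∈ b.1) : .pair p q ∈ (and a b).1 := by
  refine ⟨sn_pair (a.2.sn p hp) (b.2.sn q hq), ?_⟩
  rintro _ hr p' q' rfl
  obtain ⟨_, _, e, hp', hq'⟩ := steps_pair hr
  cases e
  exact ⟨a.2.steps hp hp', b.2.steps hq hq'⟩

theorem fst_mem (hp : p ∈ (and a b).1) : .fst p ∈ a.1 := by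
  have sp := hp.1
  induction sp with
  | intro p _ ih =>
    refine a.2.neutral _ trivial fun r hr => ?_
    cases hr with
    | fst_pair _ q => exact (hp.2 _ .refl _ _ rfl).1
    | fst h => exact ih _ h ((and a b).2.step _ hp _ h)

theorem snd_mem (hp : p ∈ (and a b).1) : .snd p ∈ b.1 := by
  have sp := hp.1
  induction sp with
  | intro p _ ih =>
    refine b.2.neutral _ trivial fun r hr => ?_
    cases hr with
    | snd_pair _ q => exact (hp.2 _ .refl _ _ rfl).2
    | snd h => exact ih _ h ((and a b).2.step _ hp _ h)

theorem inl_mem (hp : p ∈ a.1) : .inl p ∈ (or a b).1 := by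
  refine ⟨isRigid_inl.sn (a.2.sn p hp), fun r hr => ?_⟩
  obtain ⟨p', rfl, hp'⟩ := isRigid_inl.steps hr
  refine ⟨?_, nofun⟩
  rintro _ ⟨⟩
  exact a.2.steps hp hp'

theorem inr_mem (hp : p ∈ b.1) : .inr p ∈ (or a b).1 := by
  refine ⟨isRigid_inr.sn (b.2.sn p hp), fun r hr => ?_⟩
  obtain ⟨p', rfl, hp'⟩ := isRigid_inr.steps hr
  refine ⟨nofun, ?_⟩
  rintro _ ⟨⟩
  exact b.2.steps hp hp'

theorem orElim_mem (hp : p ∈ (or a b).1) (hq : ∀ u ∈ a.1, q.inst u ∈ c.1)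
    (hr : ∀ u ∈ b.1, r.inst u ∈ c.1) : .orElim p q r ∈ c.1 := by
  have sp := hp.1
  have sq := (c.2.sn _ (hq _ (a.2.var_mem 0))).of_inst
  have sr := (c.2.sn _ (hr _ (b.2.var_mem 0))).of_inst
  induction sp generalizing q r with
  | intro p _ ihp =>
    induction sq generalizing r with
    | intro q sq ihq =>
      induction sr with
      | intro r sr ihr =>
        refine c.2.neutral _ trivial fun u hu => ?_
        cases hu with
        | orElim_inl p₁ _ _ => exact hq _ ((hp.2 _ .refl).1 p₁ rfl)
        | orElim_inr p₁ _ _ => exact hr _ ((hp.2 _ .refl).2 p₁ rfl)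
        | orElim_one _ _ h =>
          exact ihp _ h ((or a b).2.step _ hp _ h) hq hr ⟨_, sq⟩ ⟨_, sr⟩
        | orElim_two _ _ h =>
          exact ihq _ h (fun u hu => c.2.step _ (hq u hu) _ (h.subst _)) hr ⟨_, sr⟩
        | orElim_three _ _ h =>
          exact ihr _ h (fun u hu => c.2.step _ (hr u hu) _ (h.subst _))

/-- `botElim` heads no redex, so strong normalization of the argument is enough for membership in an
arbitrary candidate. -/
theorem botElim_mem (hp : p ∈ (top : Candidate L).1) : .botElim p ∈ a.1 := by
  have sp := hp.1
  clear hp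
  induction sp with
  | intro p _ ih =>
    refine a.2.neutral _ trivial fun r hr => ?_
    cases hr with
    | botElim h => exact ih _ h

/-- If `A` were empty, `h` would say nothing about `p`; some member is needed to know that the body
strongly normalizes. Non-empty domains supply it. -/
theorem tlam_mem {s : L.Srt} (hA : A.Nonempty) (h : ∀ t : Term L s, ∀ a ∈ A, p.tinst t ∈ a.1) :
    .tlam s p ∈ (fa A).1 := by
  obtain ⟨a₀, ha₀⟩ := hA
  refine ⟨(isRigid_tlam s).sn (a₀.2.sn _ (h (.var s 0) a₀ ha₀)).of_tinst, ?_⟩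
  rintro _ hr s' p' rfl t a ha
  obtain ⟨p'', e, hp⟩ := (isRigid_tlam s).steps hr
  cases e
  exact a.2.steps (h t a ha) (hp.lift (fun p => p.tinst t) fun _ _ hs => hs.tsubst _)

theorem tapp_mem {s : L.Srt} (t : Term L s) (hp : p ∈ (fa A).1) (ha : a ∈ A) :
    .tapp p t ∈ a.1 := by
  have sp := hp.1
  induction sp with
  | intro p _ ih =>
    refine a.2.neutral _ trivial fun r hr => ?_
    cases hr with
    | tbeta p₁ _ => exact hp.2 _ .refl _ p₁ rfl t a ha
    | tapp _ h => exact ih _ h ((fa A).2.step _ hp _ h)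

theorem tpair_mem {s : L.Srt} (t : Term L s) (ha : a ∈ E) (hp : p ∈ a.1) :
    .tpair t p ∈ (ex E).1 := by
  refine ⟨(isRigid_tpair t).sn (a.2.sn p hp), ?_⟩
  rintro _ hr s' t' p' rfl
  obtain ⟨p'', e, hp'⟩ := (isRigid_tpair t).steps hr
  cases e
  exact ⟨a, ha, a.2.steps hp hp'⟩

/-- The truth value that contains the second component of a pair bears no relation to its witness,
hence the independent quantification over `t` and `a` in `hq`. Non-emptiness of `E` yields strong
normalization of `q`, as in `tlam_mem`. -/
theorem exElim_mem {s : L.Srt} (hE : E.Nonempty) (hp : p ∈ (ex E).1)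
    (hq : ∀ t : Term L s, ∀ a ∈ E, ∀ u ∈ a.1, (q.tinst t).inst u ∈ c.1) :
    .exElim s p q ∈ c.1 := by
  obtain ⟨a₀, ha₀⟩ := hE
  have sp := hp.1
  have sq := (c.2.sn _ (hq (.var s 0) a₀ ha₀ _ (a₀.2.var_mem 0))).of_inst.of_tinst
  induction sp generalizing q with
  | intro p _ ihp =>
    induction sq with
    | intro q sq ihq =>
      refine c.2.neutral _ trivial fun u hu => ?_
      cases hu with
      | exElim_tpair t p₁ _ =>
        obtain ⟨a, ha, hp₁⟩ := hp.2 _ .refl s t p₁ rfl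
        exact hq t a ha p₁ hp₁
      | exElim_left _ _ h => exact ihp _ h ((ex E).2.step _ hp _ h) hq ⟨_, sq⟩
      | exElim_right _ _ h =>
        exact ihq _ h fun t a ha u hu =>
          c.2.step _ (hq t a ha u hu) _ ((h.tsubst _).subst _)

end Candidate

/-! ## Adequacy -/

variable {L : Language.{u}}

/-- The proof-terms of the substitution `τ` are in the denotations of the hypotheses. -/
def Realizes (M : ValuedStructure.{u, v} L (Candidate L)) (φ : M.Assignment)
    (τ : ℕ → ProofTerm L) (Γ : List (Formula L)) : Prop :=
  ∀ n B, Γ[n]? = some B → τ n ∈ (M.denote (Candidate.algebra L) Candidate.algebra_isFull φ B).1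

namespace Realizes

variable {M : ValuedStructure.{u, v} L (Candidate L)} {φ : M.Assignment}
  {τ : ℕ → ProofTerm L} {Γ : List (Formula L)}

theorem scons (h : Realizes M φ τ Γ) {A : Formula L} {u : ProofTerm L}
    (hu : u ∈ (M.denote (Candidate.algebra L) Candidate.algebra_isFull φ A).1) :
    Realizes M φ (scons u τ) (A :: Γ) := by
  intro n B hB
  cases n with
  | zero => cases hB; exact hu
  | succ n => exact h n B hB

theorem map_shift (h : Realizes M φ τ Γ) {s : L.Srt} (e : M.Dom s) :
    Realizes M (cons (F := M.Dom) e φ) τ (Γ.map (Formula.subst (shift s))) := by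
  intro n B hB
  rw [List.getElem?_map, Option.map_eq_some_iff] at hB
  obtain ⟨A, hA, rfl⟩ := hB
  rw [M.denote_shift]
  exact h n A hA

end Realizes

/-- A proof-term that proves `A`, in which proof-terms from the denotations of the hypotheses are
substituted, is in the denotation of `A`. -/
theorem Theory.Proves.mem_denote {T : Theory L} {M : ValuedStructure.{u, v} L (Candidate L)}
    (hM : T.IsModel (Candidate.algebra L) Candidate.algebra_isFull M) {Γ : List (Formula L)}
    {p : ProofTerm L} {A : Formula L} (hp : T.Proves Γ p A) (φ : M.Assignment)
    (θ : (s : L.Srt) → ℕ → Term L s) (τ : ℕ → ProofTerm L) (hτ : Realizes M φ τ Γ) :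
    (p.tsubst θ).subst τ ∈
      (M.denote (Candidate.algebra L) Candidate.algebra_isFull φ A).1 := by
  induction hp generalizing φ θ τ with
  -- Here and below, conversion modulo the congruence is an equality of denotations in the model.
  | ax hn he => rw [← hM.formula_eq _ _ he]; exact hτ _ _ hn
  | imp_intro _ he ih =>
    rw [hM.formula_eq _ _ he]
    refine Candidate.lam_mem fun q hq => ?_
    rw [inst_subst_liftSub]
    exact ih φ θ _ (hτ.scons hq)
  | imp_elim _ _ he ihp ihq =>
    have h := ihp φ θ τ hτ
    rw [hM.formula_eq _ _ he] at h
    exact Candidate.app_mem h (ihq φ θ τ hτ)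
  | and_intro _ _ he ihp ihq =>
    rw [hM.formula_eq _ _ he]
    exact Candidate.pair_mem (ihp φ θ τ hτ) (ihq φ θ τ hτ)
  | and_left _ he ih =>
    have h := ih φ θ τ hτ
    rw [hM.formula_eq _ _ he] at h
    exact Candidate.fst_mem h
  | and_right _ he ih =>
    have h := ih φ θ τ hτ
    rw [hM.formula_eq _ _ he] at h
    exact Candidate.snd_mem h
  | or_left _ he ih =>
    rw [hM.formula_eq _ _ he]
    exact Candidate.inl_mem (ih φ θ τ hτ)
  | or_right _ he ih =>
    rw [hM.formula_eq _ _ he]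
    exact Candidate.inr_mem (ih φ θ τ hτ)
  | or_elim _ he _ _ ihp ihq ihr =>
    have h := ihp φ θ τ hτ
    rw [hM.formula_eq _ _ he] at h
    refine Candidate.orElim_mem h (fun u hu => ?_) (fun u hu => ?_)
    · rw [inst_subst_liftSub]
      exact ihq φ θ _ (hτ.scons hu)
    · rw [inst_subst_liftSub]
      exact ihr φ θ _ (hτ.scons hu)
  | top_intro he =>
    rw [hM.formula_eq _ _ he]
    exact Candidate.mem_top ⟨_, fun _ h => nomatch h⟩
  | bot_elim _ he ih =>
    have h := ih φ θ τ hτ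
    rw [hM.formula_eq _ _ he] at h
    exact Candidate.botElim_mem h
  | @all_intro _ s _ _ _ _ he ih =>
    rw [hM.formula_eq _ _ he]
    have := M.dom_nonempty s
    refine Candidate.tlam_mem (Set.range_nonempty _) ?_
    rintro t _ ⟨e, rfl⟩
    rw [tinst_subst, tinst_lift]
    -- The substitution is extended by `t` and the assignment by `e`, with no link between the two.
    exact ih _ _ _ (hτ.map_shift e)
  | @all_elim _ s _ t _ _ _ _ he hC ih =>
    have h := ih φ θ τ hτ
    rw [hM.formula_eq _ _ he] at h
    rw [hM.formula_eq _ _ hC, M.denote_single]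
    -- The proof-term carries `t.subst θ`, whereas the truth value is the one at the denotation of
    -- `t` under `φ`; `fa` allows any such pairing.
    exact Candidate.tapp_mem _ h ⟨M.termDenote φ t, rfl⟩
  | @ex_intro _ s _ t _ _ _ _ he hC ih =>
    have h := ih φ θ τ hτ
    rw [hM.formula_eq _ _ hC, M.denote_single] at h
    rw [hM.formula_eq _ _ he]
    exact Candidate.tpair_mem _ ⟨M.termDenote φ t, rfl⟩ h
  | @ex_elim _ s _ _ _ B _ _ he _ ihp ihq =>
    have h := ihp φ θ τ hτ
    rw [hM.formula_eq _ _ he] at h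
    have := M.dom_nonempty s
    refine Candidate.exElim_mem (Set.range_nonempty _) h ?_
    rintro t _ ⟨e, rfl⟩ u hu
    -- The conclusion `B` does not depend on the bound variable, so its candidate may be read under
    -- the assignment extended by `e`.
    rw [tinst_subst_liftSub, tinst_lift, inst_subst_liftSub, ← M.denote_shift _ _ B φ e]
    exact ihq _ _ _ ((hτ.map_shift e).scons hu)

/-- Proofs in a theory that has a model valued in the algebra of candidates are strongly
normalizing. -/
theorem Theory.Proves.sn {T : Theory L} {M : ValuedStructure.{u, v} L (Candidate L)}
    (hM : T.IsModel (Candidate.algebra L) Candidate.algebra_isFull M) {Γ : List (Formula L)}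
    {p : ProofTerm L} {A : Formula L} (hp : T.Proves Γ p A) : SN p := by
  let φ : M.Assignment := fun s _ => (M.dom_nonempty s).some
  -- The identity substitution realizes every context, since each candidate contains the variables.
  have h := hp.mem_denote hM φ Term.var ProofTerm.var fun n B _ =>
    (M.denote _ _ φ B).2.var_mem n
  rw [tsubst_var, subst_var] at h
  exact (M.denote _ _ φ A).2.sn _ h

end DeductionModulo

theorem mainTheorem1 {L : DeductionModulo.Language.{u}} (T : DeductionModulo.Theory L)
    (hT : DeductionModulo.Theory.SuperConsistent.{u, v} T)
    (Γ : List (DeductionModulo.Formula L)) (p : DeductionModulo.ProofTerm L)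
    (A : DeductionModulo.Formula L) (hp : T.Proves Γ p A) :
    p.StronglyNormalizing := by
  -- Candidates are sets of proof-terms of `L`, so they live in `Type u`, the universe over which
  -- super-consistency quantifies.
  obtain ⟨M, hM⟩ := hT (DeductionModulo.Candidate L) (DeductionModulo.Candidate.algebra L)
    DeductionModulo.Candidate.algebra_isFull DeductionModulo.Candidate.algebra_isOrdered
    DeductionModulo.Candidate.isCompleteOrder
  exact (hp.sn hM).stronglyNormalizing
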